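/- Let $\mathfrak R$ be a complete, separated, right linear topological ring (associative and unital, not necessarily commutative); that is, open right ideals form a base of neighborhoods of zero in $\mathfrak R$, and the natural map $\mathfrak R\to\varprojlim_{\mathfrak I}\mathfrak R/\mathfrak I$, where $\mathfrak I$ ranges over the open right ideals, is bijective. For a set $X$, let $\mathfrak R[[X]]$ be the set of all infinite formal linear combinations $\sum_{x\in X}r_xx$ whose family of coefficients $(r_x\in\mathfrak R)_{x\in X}$ converges to zero (for every open right ideal $\mathfrak I$ one has $r_x\in\mathfrak I$ for all but finitely many $x$). The functor $X\mapsto\mathfrak R[[X]]$ is a monad on the category of sets, with the point measure maps $X\to\mathfrak R[[X]]$ as the unit and the opening of parentheses $\mathfrak R[[\mathfrak R[[X]]]]\to\mathfrak R[[X]]$ as the multiplication; left $\mathfrak R$-contramodules are the algebras (modules) over this monad, and $\mathfrak R\text{-contra}$ denotes their category. A projective cover of an object $F$ is a morphism $p\colon P\to F$ with $P$ projective such that every morphism $P'\to F$ with $P'$ projective factors through $p$, and every endomorphism $f\colon P\to P$ with $pf=p$ is an automorphism. Let $(f_{y,x}\colon P_x\to P_y)_{x<y\in X}$ be a diagram of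 projective left $\mathfrak R$-contramodules indexed by an arbitrary directed poset $X$, and let $F=\varinjlim_{x\in X}P_x$ be its colimit in $\mathfrak R\text{-contra}$. Assume that $F$ has a projective cover in $\mathfrak R\text{-contra}$. Then $F$ is a projective left $\mathfrak R$-contramodule. -/

import Mathlib

open CategoryTheory CategoryTheory.Limits Filter Topology

universe u

set_option linter.unusedSectionVars false

/-! ### Precovers and covers -/

section Covers

variable {C : Type*} [Category C]

/-- `l : L ⟶ A` is an `𝓛`-precover of `A`: `L` lies in the class `𝓛`, and every morphism to `A`
from an object of `𝓛` factors through `l`. -/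
structure IsPrecover (𝓛 : ObjectProperty C) {L A : C} (l : L ⟶ A) : Prop where
  mem : 𝓛 L
  exists_fac : ∀ (L' : C) (l' : L' ⟶ A), 𝓛 L' → ∃ f : L' ⟶ L, f ≫ l = l'

/-- An `𝓛`-cover is an `𝓛`-precover `l : L ⟶ A` such that every endomorphism `f` of `L` with
`f ≫ l = l` is an automorphism. -/
structure IsCover (𝓛 : ObjectProperty C) {L A : C} (l : L ⟶ A) : Prop
    extends IsPrecover 𝓛 l where
  isIso_of_fac : ∀ f : L ⟶ L, f ≫ l = l → IsIso f

/-- `A` has a projective cover. -/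
def HasProjectiveCover (A : C) : Prop :=
  ∃ (P : C) (p : P ⟶ A), IsCover (fun X : C => Projective X) p

end Covers

/-! ### Zero-convergent families -/

/-- `ZeroConv R X` is the set `R[[X]]` of all infinite formal linear combinations `∑ r_x x` of
elements of `X` whose family of coefficients `r : X → R` converges to zero. -/
@[ext]
structure ZeroConv (R : Type*) [Zero R] [TopologicalSpace R] (X : Type*) where
  coeff : X → R
  tendsto_zero : Tendsto coeff cofinite (𝓝 0)

namespace ZeroConv

variable {R : Type*} [Ring R] [UniformSpace R] [IsUniformAddGroup R] [IsTopologicalRing R]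
  [IsLinearTopology Rᵐᵒᵖ R]

/-- A family converges to zero iff, for every open right ideal `I`, all but finitely many of its
members lie in `I`. -/
theorem tendsto_iff {ι : Type*} {f : ι → R} :
    Tendsto f cofinite (𝓝 0) ↔
      ∀ I : Submodule Rᵐᵒᵖ R, IsOpen (I : Set R) → {i | f i ∉ I}.Finite := by
  rw [(IsLinearTopology.hasBasis_open_submodule (R := Rᵐᵒᵖ) (M := R)).tendsto_right_iff]
  rfl

theorem nonarchimedean : NonarchimedeanAddGroup R where
  is_nonarchimedean U hU := by
    obtain ⟨I, hI, hIU⟩ :=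
      (IsLinearTopology.hasBasis_open_submodule (R := Rᵐᵒᵖ) (M := R)).mem_iff.1 hU
    exact ⟨⟨I.toAddSubgroup, hI⟩, hIU⟩

theorem mul_mem_right {I : Submodule Rᵐᵒᵖ R} {a : R} (ha : a ∈ I) (b : R) : a * b ∈ I :=
  I.smul_mem (MulOpposite.op b) ha

theorem tsum_mem_of_forall {I : Submodule Rᵐᵒᵖ R} (hI : IsOpen (I : Set R)) {ι : Type*}
    {f : ι → R} (h : ∀ i, f i ∈ I) : ∑' i, f i ∈ I := by
  have hc : IsClosed (I : Set R) := I.toAddSubgroup.isClosed_of_isOpen hI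
  by_cases hs : Summable f
  · exact hc.mem_of_tendsto hs.hasSum
      (Eventually.of_forall fun s => I.sum_mem fun i _ => h i)
  · rw [tsum_eq_zero_of_not_summable hs]
    exact I.zero_mem

theorem tendsto_mul_right {ι : Type*} {f : ι → R} (hf : Tendsto f cofinite (𝓝 0)) (h : ι → R) :
    Tendsto (fun i => f i * h i) cofinite (𝓝 0) := by
  rw [tendsto_iff] at hf ⊢
  exact fun I hI => (hf I hI).subset fun i hi hfi => hi (mul_mem_right hfi _)

/-- Summing a zero-convergent family along the fibres of a map gives a zero-convergent family. -/
theorem tendsto_fiber {ι Y : Type*} {f : ι → R} (hf : Tendsto f cofinite (𝓝 0)) (p : ι → Y) :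
    Tendsto (fun y => ∑' i : p ⁻¹' {y}, f i) cofinite (𝓝 0) := by
  rw [tendsto_iff] at hf ⊢
  intro I hI
  refine ((hf I hI).image p).subset fun y hy => ?_
  by_contra hne
  refine hy (tsum_mem_of_forall hI fun i => ?_)
  by_contra hi
  exact hne ⟨i, hi, i.2⟩

/-- The coefficients `ρ_s s_x` that appear when the parentheses are opened in `∑_s ρ_s (∑_x s_x x)`
form a zero-convergent family. -/
theorem tendsto_open {X : Type*} (ρ : ZeroConv R (ZeroConv R X)) :
    Tendsto (fun q : ZeroConv R X × X => ρ.coeff q.1 * q.1.coeff q.2) cofinite (𝓝 0) := by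
  rw [tendsto_iff]
  intro I hI
  have h1 := tendsto_iff.1 ρ.tendsto_zero I hI
  have h2 : ∀ s : ZeroConv R X, {x | ρ.coeff s * s.coeff x ∉ I}.Finite := fun s => by
    have : Tendsto (fun x => ρ.coeff s * s.coeff x) cofinite (𝓝 0) := by
      simpa using s.tendsto_zero.const_mul (ρ.coeff s)
    exact tendsto_iff.1 this I hI
  refine (h1.biUnion fun s _ => (h2 s).image (Prod.mk s)).subset ?_
  rintro ⟨s, x⟩ hq
  simp only [Set.mem_iUnion, Set.mem_image, Set.mem_ofPred_eq]
  exact ⟨s, fun hs => hq (mul_mem_right hs _), x, hq, rfl⟩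

theorem tendsto_tsum_open {X : Type*} (ρ : ZeroConv R (ZeroConv R X)) :
    Tendsto (fun x => ∑' s : ZeroConv R X, ρ.coeff s * s.coeff x) cofinite (𝓝 0) := by
  have h := tendsto_open ρ
  rw [tendsto_iff] at h ⊢
  intro I hI
  refine ((h I hI).image Prod.snd).subset fun x hx => ?_
  by_contra hne
  refine hx (tsum_mem_of_forall hI fun s => ?_)
  by_contra hs
  exact hne ⟨(s, x), hs, rfl⟩

/-- The map `R[[f]] : R[[X]] → R[[Y]]` induced by `f : X → Y`, sending `∑ r_x x` to `∑ s_y y`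
with `s_y = ∑_{f x = y} r_x`. -/
noncomputable def map {X Y : Type*} (f : X → Y) (r : ZeroConv R X) : ZeroConv R Y where
  coeff y := ∑' x : f ⁻¹' {y}, r.coeff x
  tendsto_zero := tendsto_fiber r.tendsto_zero f

open Classical in
/-- The point measure map `ε : X → R[[X]]`. -/
noncomputable def point {X : Type*} (x : X) : ZeroConv R X where
  coeff y := if y = x then 1 else 0
  tendsto_zero := by
    rw [tendsto_iff]
    intro I _
    refine (Set.finite_singleton x).subset fun y hy => ?_
    by_contra hne
    refine hy ?_
    rw [if_neg (show ¬ y = x from hne)]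
    exact I.zero_mem

/-- The opening of parentheses `φ : R[[R[[X]]]] → R[[X]]`, sending `∑_s ρ_s s` to the formal
linear combination whose coefficient at `x` is `∑_s ρ_s s_x`. -/
noncomputable def openParens {X : Type*} (ρ : ZeroConv R (ZeroConv R X)) : ZeroConv R X where
  coeff x := ∑' s : ZeroConv R X, ρ.coeff s * s.coeff x
  tendsto_zero := tendsto_tsum_open ρ

/-- The sum `∑ r_x h_x`, for `r` in `R[[X]]` and any family `h : X → R`. -/
noncomputable def pair {X : Type*} (r : ZeroConv R X) (h : X → R) : R :=
  ∑' x, r.coeff x * h x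

open Classical in
theorem pair_ite {X : Type*} (r : ZeroConv R X) (x : X) :
    r.pair (fun y => if y = x then 1 else 0) = r.coeff x := by
  simp [pair]

theorem ext_pair {X : Type*} {r s : ZeroConv R X} (h : ∀ g, r.pair g = s.pair g) : r = s := by
  classical
  ext x
  rw [← pair_ite r x, ← pair_ite s x]
  exact h _

theorem pair_point {X : Type*} (x : X) (h : X → R) : (point x).pair h = h x := by
  simp [pair, point]

variable [CompleteSpace R] [T2Space R]

theorem summable {ι : Type*} {f : ι → R} (hf : Tendsto f cofinite (𝓝 0)) : Summable f :=
  haveI := nonarchimedean (R := R)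
  NonarchimedeanAddGroup.summable_of_tendsto_cofinite_zero hf

theorem pair_map {X Y : Type*} (f : X → Y) (r : ZeroConv R X) (h : Y → R) :
    (map f r).pair h = r.pair (fun x => h (f x)) := by
  have hs := summable (tendsto_mul_right r.tendsto_zero fun x => h (f x))
  refine Eq.trans (tsum_congr fun y => ?_) (hs.hasSum.tsum_fiberwise f).tsum_eq
  have hr : Summable fun x : f ⁻¹' {y} => r.coeff x :=
    (summable r.tendsto_zero).comp_injective Subtype.val_injective
  simp only [map]
  rw [← hr.tsum_mul_right]
  refine tsum_congr fun x => ?_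
  rw [show f x = y from x.2]

theorem summable_open {X : Type*} (ρ : ZeroConv R (ZeroConv R X)) (x : X) :
    Summable fun s : ZeroConv R X => ρ.coeff s * s.coeff x :=
  (summable (tendsto_open ρ)).comp_injective (i := fun s => (s, x))
    fun _ _ h => congrArg Prod.fst h

theorem tsum_open_comm {X : Type*} (ρ : ZeroConv R (ZeroConv R X)) (h : X → R) :
    ∑' x, ∑' s : ZeroConv R X, ρ.coeff s * s.coeff x * h x =
      ∑' s : ZeroConv R X, ∑' x, ρ.coeff s * s.coeff x * h x := by
  have hs : Summable (Function.uncurry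
      fun (s : ZeroConv R X) (x : X) => ρ.coeff s * s.coeff x * h x) :=
    summable (tendsto_mul_right (tendsto_open ρ) fun q => h q.2)
  exact hs.tsum_comm

theorem pair_openParens {X : Type*} (ρ : ZeroConv R (ZeroConv R X)) (h : X → R) :
    (openParens ρ).pair h = ρ.pair (fun s => s.pair h) := by
  have h1 : (openParens ρ).pair h = ∑' x, ∑' s : ZeroConv R X, ρ.coeff s * s.coeff x * h x :=
    tsum_congr fun x => ((summable_open ρ x).tsum_mul_right (h x)).symm
  rw [h1, tsum_open_comm]
  refine tsum_congr fun s => ?_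
  simp only [mul_assoc]
  exact (summable (tendsto_mul_right s.tendsto_zero h)).tsum_mul_left (ρ.coeff s)

end ZeroConv

/-! ### Contramodules -/

section Contramodules

variable (R : Type u) [Ring R] [UniformSpace R] [IsUniformAddGroup R] [IsTopologicalRing R]
  [IsLinearTopology Rᵐᵒᵖ R] [CompleteSpace R] [T2Space R]

/-- The functor `X ↦ R[[X]]` from sets to sets. -/
noncomputable def zeroConvFunctor : Type u ⥤ Type u where
  obj X := ZeroConv R X
  map f := TypeCat.ofHom (ZeroConv.map (R := R) f)
  map_id X := by
    apply ConcreteCategory.hom_ext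
    intro r
    refine ZeroConv.ext_pair (R := R) fun h => ?_
    exact ZeroConv.pair_map _ r h
  map_comp f g := by
    apply ConcreteCategory.hom_ext
    intro r
    refine ZeroConv.ext_pair (R := R) fun h => ?_
    exact (ZeroConv.pair_map _ r h).trans
      ((ZeroConv.pair_map g (ZeroConv.map f r) h).trans (ZeroConv.pair_map f r _)).symm

/-- The monad `(R[[-]], φ, ε)` on the category of sets, for a complete, separated right linear
topological ring `R`. -/
noncomputable def contraMonad : Monad (Type u) where
  toFunctor := zeroConvFunctor R
  η :=
    { app := fun X => TypeCat.ofHom (ZeroConv.point (R := R) (X := X))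
      naturality := fun X Y f => by
        apply ConcreteCategory.hom_ext
        intro x
        refine ZeroConv.ext_pair (R := R) fun h => ?_
        exact (ZeroConv.pair_point _ h).trans
          ((ZeroConv.pair_map _ _ h).trans (ZeroConv.pair_point x _)).symm }
  μ :=
    { app := fun X => TypeCat.ofHom (ZeroConv.openParens (R := R) (X := X))
      naturality := fun X Y f => by
        apply ConcreteCategory.hom_ext
        intro ρ
        refine ZeroConv.ext_pair (R := R) fun h => ?_
        refine (ZeroConv.pair_openParens _ h).trans ((ZeroConv.pair_map _ ρ _).trans ?_)
        refine Eq.trans ?_ ((ZeroConv.pair_map _ _ h).trans (ZeroConv.pair_openParens ρ _)).symm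
        exact congrArg _ (funext fun s => ZeroConv.pair_map _ s h) }
  assoc X := by
    apply ConcreteCategory.hom_ext
    intro τ
    refine ZeroConv.ext_pair (R := R) fun h => ?_
    refine (ZeroConv.pair_openParens _ h).trans ((ZeroConv.pair_map _ τ _).trans ?_)
    refine Eq.trans ?_ ((ZeroConv.pair_openParens _ h).trans (ZeroConv.pair_openParens τ _)).symm
    exact congrArg _ (funext fun s => ZeroConv.pair_openParens s h)
  left_unit X := by
    apply ConcreteCategory.hom_ext
    intro r
    refine ZeroConv.ext_pair (R := R) fun h => ?_
    exact (ZeroConv.pair_openParens _ h).trans (ZeroConv.pair_point r _)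
  right_unit X := by
    apply ConcreteCategory.hom_ext
    intro r
    refine ZeroConv.ext_pair (R := R) fun h => ?_
    refine (ZeroConv.pair_openParens _ h).trans ((ZeroConv.pair_map _ r _).trans ?_)
    exact congrArg _ (funext fun x => ZeroConv.pair_point x h)

/-- The category `R`-contra of left `R`-contramodules: algebras (modules) over the monad
`(R[[-]], φ, ε)`. -/
abbrev Contra : Type (u + 1) := (contraMonad R).Algebra

end Contramodules

/-!
The kernel of a projective cover `p : Q → F` of a direct limit `F` of projective contramodules
`P x` is shown to be zero, by an approximation argument. For an open right ideal `I` and a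
contramodule `A`, let `I A` be the subgroup of values of infinite linear combinations of elements
of `A` with coefficients in `I`.

Direct limits of contramodules are not exact, but the functor `A ↦ A / I A` to abelian groups
preserves them (`Contra.exists_map_mem_idealMul`): it is left adjoint to the functor
`D ↦ Hom(R/I, D)`, and testing the colimit against the contramodule `Contra.coind` for `D` the
direct limit of the groups `P x / I (P x)` gives the claim. Now the free contramodule on the
disjoint union of the sets `P x` maps onto `F`. Modulo `I`, an element of it has only finitely many
nonzero terms, which can all be pushed forward to a common late index; so an element vanishing in
`F` is sent into `I Q` by a suitable map to `Q` over `F` (`Contra.exists_lift_mem_idealMul`).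
Composing with a lift of `p` to the free contramodule, one gets for every `k` in the kernel of `p`
an endomorphism of `Q` over `F` that takes `k` into `I Q`. The endomorphism is invertible since `p`
is a cover, and automorphisms preserve `I Q`, so `k` lies in `I Q`. This holds for all `I`, and
projective contramodules are separated (`Contra.eq_zero_of_forall_mem_idealMul`), so `k = 0`.

Since `p` is injective, the lifts `P x → Q` of the cocone maps are compatible and induce a section
of `p` on `F`. Hence `F` is a retract of `Q`.
-/

/-! ### Additive structure of formal linear combinations -/

namespace ZeroConv

variable {R : Type*} [Ring R] [UniformSpace R] [IsUniformAddGroup R] [IsTopologicalRing R]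
  [IsLinearTopology Rᵐᵒᵖ R]

section AddCommGroup

variable {X : Type*}

instance : Zero (ZeroConv R X) := ⟨⟨fun _ => 0, tendsto_const_nhds⟩⟩

instance : Add (ZeroConv R X) :=
  ⟨fun r s => ⟨fun x => r.coeff x + s.coeff x, by
    simpa using r.tendsto_zero.add s.tendsto_zero⟩⟩

instance : Neg (ZeroConv R X) :=
  ⟨fun r => ⟨fun x => - r.coeff x, by simpa using r.tendsto_zero.neg⟩⟩

@[simp] theorem coeff_zero (x : X) : (0 : ZeroConv R X).coeff x = 0 := rfl

@[simp] theorem coeff_add (r s : ZeroConv R X) (x : X) :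
    (r + s).coeff x = r.coeff x + s.coeff x := rfl

@[simp] theorem coeff_neg (r : ZeroConv R X) (x : X) : (-r).coeff x = - r.coeff x := rfl

instance : AddCommGroup (ZeroConv R X) :=
  { AddGroup.ofLeftAxioms (G := ZeroConv R X)
      (fun a b c => by ext x; simp [add_assoc])
      (fun a => by ext x; simp) (fun a => by ext x; simp) with
    add_comm := fun a b => by ext x; simp [add_comm] }

@[simp] theorem coeff_sub (r s : ZeroConv R X) (x : X) :
    (r - s).coeff x = r.coeff x - s.coeff x := by
  rw [sub_eq_add_neg, sub_eq_add_neg, coeff_add, coeff_neg]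

/-- Reading off a coefficient, as a homomorphism of additive groups. -/
def coeffHom (x : X) : ZeroConv R X →+ R where
  toFun r := r.coeff x
  map_zero' := rfl
  map_add' _ _ := rfl

end AddCommGroup

/-- The subgroup `I[[X]]` of the formal linear combinations whose coefficients all lie in the
right ideal `I`. -/
def coeffIn (I : Submodule Rᵐᵒᵖ R) (X : Type*) : AddSubgroup (ZeroConv R X) where
  carrier := {r | ∀ x, r.coeff x ∈ I}
  zero_mem' _ := I.zero_mem
  add_mem' hr hs x := I.add_mem (hr x) (hs x)
  neg_mem' hr x := I.neg_mem (hr x)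

theorem map_mem_coeffIn {I : Submodule Rᵐᵒᵖ R} (hI : IsOpen (I : Set R)) {X Y : Type*}
    {r : ZeroConv R X} (hr : r ∈ coeffIn I X) (f : X → Y) : map f r ∈ coeffIn I Y :=
  fun _ => tsum_mem_of_forall hI fun i => hr i

theorem openParens_mem_coeffIn {I : Submodule Rᵐᵒᵖ R} (hI : IsOpen (I : Set R)) {X : Type*}
    {ρ : ZeroConv R (ZeroConv R X)} (hρ : ρ ∈ coeffIn I _) : openParens ρ ∈ coeffIn I X :=
  fun _ => tsum_mem_of_forall hI fun s => mul_mem_right (hρ s) _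

theorem finite_notMem {X : Type*} (r : ZeroConv R X) {I : Submodule Rᵐᵒᵖ R}
    (hI : IsOpen (I : Set R)) : {x | r.coeff x ∉ I}.Finite :=
  tendsto_iff.1 r.tendsto_zero I hI

/-- Multiplication of all coefficients by a fixed scalar on the left. -/
def mulLeft {X : Type*} (v : R) (r : ZeroConv R X) : ZeroConv R X where
  coeff x := v * r.coeff x
  tendsto_zero := by simpa using r.tendsto_zero.const_mul v

/-- The formal linear combination `v x` with only one term. -/
noncomputable def single {X : Type*} (x : X) : R →+ ZeroConv R X where
  toFun v := mulLeft v (point x)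
  map_zero' := by ext y; simp [mulLeft]
  map_add' v w := by ext y; simp [mulLeft, add_mul]

open Classical in
theorem coeff_single {X : Type*} (x : X) (v : R) (y : X) :
    (single x v).coeff y = if y = x then v else 0 := by
  simp [single, mulLeft, point]

theorem single_one {X : Type*} (x : X) : single x (1 : R) = point x := by
  ext y; simp [single, mulLeft]

/-- The terms of `r` indexed by a set `S`. -/
def restrict {X : Type*} (S : Set X) (r : ZeroConv R X) : ZeroConv R S where
  coeff x := r.coeff x
  tendsto_zero := r.tendsto_zero.comp Subtype.val_injective.tendsto_cofinite

open Classical in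
theorem coeff_map_restrict {X : Type*} (S : Set X) (r : ZeroConv R X) (x : X) :
    (map (fun z : S => (z : X)) (restrict S r)).coeff x = if x ∈ S then r.coeff x else 0 := by
  change ∑' z : (fun z : S => (z : X)) ⁻¹' {x}, r.coeff z = _
  split_ifs with h
  · rw [tsum_eq_single ⟨⟨x, h⟩, rfl⟩]
    rintro ⟨z, hz⟩ hne
    exact absurd (Subtype.ext (Subtype.ext (show (z : X) = x from hz))) hne
  · have : IsEmpty ((fun z : S => (z : X)) ⁻¹' {x}) :=
      ⟨fun z => h (by have := z.2; simp only [Set.mem_preimage, Set.mem_singleton_iff] at this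
                      exact this ▸ z.1.2)⟩
    exact tsum_empty

theorem sub_map_restrict_mem {X : Type*} {I : Submodule Rᵐᵒᵖ R} {S : Set X} {r : ZeroConv R X}
    (h : ∀ x, x ∉ S → r.coeff x ∈ I) :
    r - map (fun z : S => (z : X)) (restrict S r) ∈ coeffIn I X := by
  classical
  intro x
  rw [coeff_sub, coeff_map_restrict]
  split_ifs with hx
  · simp
  · simpa using h x hx

section Discrete

variable {D : Type*} [AddCommGroup D] [TopologicalSpace D] [DiscreteTopology D]

/-- An additive map on `R[[X]]` that kills the combinations with coefficients in an open right
ideal is determined by its values on the one-term combinations. -/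
theorem apply_eq_tsum_single {X : Type*} {I : Submodule Rᵐᵒᵖ R} (hI : IsOpen (I : Set R))
    (ψ : ZeroConv R X →+ D) (hψ : ∀ r ∈ coeffIn I X, ψ r = 0) (r : ZeroConv R X) :
    ψ r = ∑' x, ψ (single x (r.coeff x)) := by
  classical
  have hfin := r.finite_notMem hI
  have hsingle : ∀ x, r.coeff x ∈ I → ψ (single x (r.coeff x)) = 0 := fun x hx =>
    hψ _ fun y => by
      rw [coeff_single]
      split_ifs
      · exact hx
      · exact I.zero_mem
  rw [tsum_eq_sum (s := hfin.toFinset) (fun x hx => hsingle x (by simpa using hx)), ← map_sum,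
    ← sub_eq_zero, ← map_sub]
  refine hψ _ fun y => ?_
  have h : (∑ x ∈ hfin.toFinset, single x (r.coeff x)).coeff y =
      if r.coeff y ∈ I then 0 else r.coeff y := by
    change coeffHom y _ = _
    rw [map_sum]
    simp only [coeffHom, AddMonoidHom.coe_mk, ZeroHom.coe_mk, coeff_single]
    rw [Finset.sum_ite_eq]
    simp
  rw [coeff_sub, h]
  split_ifs with hy
  · simpa using hy
  · simp

end Discrete

variable [CompleteSpace R] [T2Space R]

theorem pair_add {X : Type*} (r s : ZeroConv R X) (h : X → R) :
    (r + s).pair h = r.pair h + s.pair h := by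
  simp only [pair, coeff_add, add_mul]
  exact (summable (tendsto_mul_right r.tendsto_zero h)).tsum_add
    (summable (tendsto_mul_right s.tendsto_zero h))

theorem pair_mulLeft {X : Type*} (v : R) (r : ZeroConv R X) (h : X → R) :
    (mulLeft v r).pair h = v * r.pair h := by
  simp only [pair, mulLeft, mul_assoc]
  exact (summable (tendsto_mul_right r.tendsto_zero h)).tsum_mul_left v

theorem pair_single {X : Type*} (x : X) (v : R) (h : X → R) :
    (single x v).pair h = v * h x :=
  (pair_mulLeft v (point x) h).trans (by rw [pair_point])

theorem map_add {X Y : Type*} (f : X → Y) (r s : ZeroConv R X) :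
    map f (r + s) = map f r + map f s :=
  ext_pair fun h => by simp only [pair_map, pair_add]

theorem openParens_add {X : Type*} (ρ σ : ZeroConv R (ZeroConv R X)) :
    openParens (ρ + σ) = openParens ρ + openParens σ :=
  ext_pair fun h => by simp only [pair_openParens, pair_add]

theorem map_map {X Y Z : Type*} (g : Y → Z) (f : X → Y) (r : ZeroConv R X) :
    map g (map f r) = map (fun x => g (f x)) r :=
  ext_pair fun h => by simp only [pair_map]

theorem map_point {X Y : Type*} (f : X → Y) (x : X) :
    map f (point x : ZeroConv R X) = point (f x) :=
  ext_pair fun h => by simp only [pair_map, pair_point]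

theorem map_single {X Y : Type*} (f : X → Y) (x : X) (v : R) :
    map f (single x v) = single (f x) v :=
  ext_pair fun h => by simp only [pair_map, pair_single]

theorem map_openParens {X Y : Type*} (f : X → Y) (ρ : ZeroConv R (ZeroConv R X)) :
    map f (openParens ρ) = openParens (map (map f) ρ) :=
  ext_pair fun h => by simp only [pair_openParens, pair_map]

theorem openParens_point {X : Type*} (r : ZeroConv R X) : openParens (point r) = r :=
  ext_pair fun h => by simp only [pair_openParens, pair_point]

theorem openParens_single {X : Type*} (r : ZeroConv R X) (v : R) :
    openParens (single r v) = mulLeft v r :=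
  ext_pair fun h => by simp only [pair_openParens, pair_single, pair_mulLeft]

theorem openParens_map_point {X : Type*} (r : ZeroConv R X) : openParens (map point r) = r :=
  ext_pair fun h => by simp only [pair_openParens, pair_map, pair_point]

end ZeroConv

/-! ### Contraactions and their additive groups -/

namespace Contra

open ZeroConv

variable {R : Type u} [Ring R] [UniformSpace R] [IsUniformAddGroup R] [IsTopologicalRing R]
  [IsLinearTopology Rᵐᵒᵖ R] [CompleteSpace R] [T2Space R]

/-- The contraaction `R[[A]] → A`, assigning to a formal linear combination its value. -/
def str (A : Contra R) (r : ZeroConv R A.A) : A.A := (ConcreteCategory.hom A.a) r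

theorem str_point (A : Contra R) (x : A.A) : str A (point x) = x :=
  ConcreteCategory.congr_hom A.unit x

theorem str_openParens (A : Contra R) (ρ : ZeroConv R (ZeroConv R A.A)) :
    str A (openParens ρ) = str A (ZeroConv.map (str A) ρ) :=
  ConcreteCategory.congr_hom A.assoc ρ

theorem str_surjective (A : Contra R) : Function.Surjective (str A) :=
  fun x => ⟨point x, str_point A x⟩

/-- The contramodule with contraaction `a`. -/
def ofStr (A : Type u) (a : ZeroConv R A → A) (unit : ∀ x, a (point x) = x)
    (assoc : ∀ ρ, a (openParens ρ) = a (ZeroConv.map a ρ)) : Contra R where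
  A := A
  a := TypeCat.ofHom a
  unit := by
    apply ConcreteCategory.hom_ext
    exact unit
  assoc := by
    apply ConcreteCategory.hom_ext
    exact assoc

/-- The map of sets underlying a morphism of contramodules. -/
def app {A B : Contra R} (f : A ⟶ B) (x : A.A) : B.A := (ConcreteCategory.hom f.f) x

theorem app_str {A B : Contra R} (f : A ⟶ B) (r : ZeroConv R A.A) :
    app f (str A r) = str B (ZeroConv.map (app f) r) :=
  (ConcreteCategory.congr_hom f.h r).symm

/-- A map of sets compatible with the contraactions, as a morphism. -/
def ofApp {A B : Contra R} (f : A.A → B.A)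
    (hf : ∀ r, f (str A r) = str B (ZeroConv.map f r)) : A ⟶ B where
  f := TypeCat.ofHom f
  h := by
    apply ConcreteCategory.hom_ext
    exact fun r => (hf r).symm

theorem app_comp {A B C : Contra R} (f : A ⟶ B) (g : B ⟶ C) (x : A.A) :
    app (f ≫ g) x = app g (app f x) := rfl

theorem app_id (A : Contra R) (x : A.A) : app (𝟙 A) x = x := rfl

theorem hom_ext {A B : Contra R} {f g : A ⟶ B} (h : ∀ x, app f x = app g x) : f = g := by
  apply Monad.Algebra.Hom.ext
  apply ConcreteCategory.hom_ext
  exact h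

section AddCommGroup

variable (A : Contra R)

instance : Zero A.A := ⟨str A 0⟩

noncomputable instance : Add A.A := ⟨fun x y => str A (point x + point y)⟩

noncomputable instance : Neg A.A := ⟨fun x => str A (-point x)⟩

theorem str_zero : str A 0 = 0 := rfl

/-- The contraaction is additive: `r + s` is obtained by opening the parentheses in the two-term
sum of `r` and `s`, and the contraaction is associative. -/
theorem str_add (r s : ZeroConv R A.A) : str A (r + s) = str A r + str A s := by
  have h : r + s = openParens (point r + point s) := by
    rw [openParens_add, openParens_point, openParens_point]
  rw [h, str_openParens, ZeroConv.map_add, map_point, map_point]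
  rfl

theorem str_neg (r : ZeroConv R A.A) : str A (-r) = - str A r := by
  have map_neg : ∀ ρ : ZeroConv R (ZeroConv R A.A),
      ZeroConv.map (str A) (-ρ) = - ZeroConv.map (str A) ρ :=
    (AddMonoidHom.mk' _ (ZeroConv.map_add (R := R) (str A))).map_neg
  have h : - r = openParens (- point r) := by
    have := (AddMonoidHom.mk' _ (openParens_add (R := R) (X := A.A))).map_neg (point r)
    simp only [AddMonoidHom.mk'_apply] at this
    rw [this, openParens_point]
  rw [h, str_openParens, map_neg, map_point]
  rfl

/-- The additive group underlying a contramodule. Its addition is the value of the two-term formal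
sums; the axioms hold because they hold in `R[[A]]`, from which the contraaction is a surjection
respecting the operations. -/
noncomputable instance : AddCommGroup A.A :=
  { AddGroup.ofLeftAxioms (G := A.A)
      (fun a b c => by
        obtain ⟨a, rfl⟩ := str_surjective A a
        obtain ⟨b, rfl⟩ := str_surjective A b
        obtain ⟨c, rfl⟩ := str_surjective A c
        simp only [← str_add, add_assoc])
      (fun a => by
        obtain ⟨a, rfl⟩ := str_surjective A a
        rw [← str_zero, ← str_add, zero_add])
      (fun a => by
        obtain ⟨a, rfl⟩ := str_surjective A a
        rw [← str_zero, ← str_neg, ← str_add, neg_add_cancel]) with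
    add_comm := fun a b => by
      obtain ⟨a, rfl⟩ := str_surjective A a
      obtain ⟨b, rfl⟩ := str_surjective A b
      simp only [← str_add, add_comm] }

/-- The contraaction as a homomorphism of additive groups. -/
noncomputable def strHom : ZeroConv R A.A →+ A.A := AddMonoidHom.mk' (str A) (str_add A)

end AddCommGroup

theorem app_add {A B : Contra R} (f : A ⟶ B) (x y : A.A) : app f (x + y) = app f x + app f y := by
  obtain ⟨x, rfl⟩ := str_surjective A x
  obtain ⟨y, rfl⟩ := str_surjective A y
  simp only [← str_add, app_str, ZeroConv.map_add]

/-- The homomorphism of additive groups underlying a morphism of contramodules. -/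
noncomputable def appHom {A B : Contra R} (f : A ⟶ B) : A.A →+ B.A :=
  AddMonoidHom.mk' (app f) (app_add f)

/-- The subgroup `I A` of a contramodule `A`: the values of all (infinite) formal linear
combinations of elements of `A` with coefficients in the right ideal `I`. -/
noncomputable def idealMul (I : Submodule Rᵐᵒᵖ R) (A : Contra R) : AddSubgroup A.A :=
  (coeffIn I A.A).map (strHom A)

theorem app_mem_idealMul {I : Submodule Rᵐᵒᵖ R} (hI : IsOpen (I : Set R)) {A B : Contra R}
    (f : A ⟶ B) {x : A.A} (hx : x ∈ idealMul I A) : app f x ∈ idealMul I B := by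
  obtain ⟨r, hr, rfl⟩ := hx
  exact ⟨_, map_mem_coeffIn hI hr (app f), (app_str f r).symm⟩

/-! ### Free contramodules -/

variable (R) in
/-- The free contramodule `R[[X]]`. -/
noncomputable abbrev free (X : Type u) : Contra R := (contraMonad R).free.obj X

/-- An element of `R[[X]]` as an element of the free contramodule. -/
def toFree {X : Type u} (r : ZeroConv R X) : (free R X).A := r

/-- The morphism from the free contramodule on `X` extending a map `X → A`. -/
noncomputable def lift {X : Type u} {A : Contra R} (b : X → A.A) : free R X ⟶ A :=
  ofApp (fun r => str A (ZeroConv.map b r)) fun (ρ : ZeroConv R (ZeroConv R X)) =>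
    (congrArg (str A) (map_openParens b ρ)).trans <|
      (str_openParens A _).trans (congrArg (str A) (ZeroConv.map_map _ _ ρ))

theorem app_lift {X : Type u} {A : Contra R} (b : X → A.A) (r : ZeroConv R X) :
    app (lift b) (toFree r) = str A (ZeroConv.map b r) := rfl

theorem app_lift_point {X : Type u} {A : Contra R} (b : X → A.A) (x : X) :
    app (lift b) (toFree (point x)) = b x := by
  rw [app_lift, map_point, str_point]

/-- A morphism from a free contramodule is determined by its values on the generators. -/
theorem app_free {X : Type u} {A : Contra R} (g : free R X ⟶ A) (r : ZeroConv R X) :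
    app g (toFree r) = str A (ZeroConv.map (fun x => app g (toFree (point x))) r) := by
  have h : app g (toFree (openParens (ZeroConv.map point r))) = _ :=
    app_str g (ZeroConv.map (fun x => toFree (point x)) r)
  rw [openParens_map_point] at h
  exact h.trans (congrArg _ (ZeroConv.map_map (app g) _ r))

theorem free_hom_ext {X : Type u} {A : Contra R} {g g' : free R X ⟶ A}
    (h : ∀ x, app g (toFree (point x)) = app g' (toFree (point x))) : g = g' :=
  hom_ext fun r => by
    refine (app_free g r).trans (Eq.trans ?_ (app_free g' r).symm)
    simp only [h]

theorem toFree_mem_idealMul {I : Submodule Rᵐᵒᵖ R} (hI : IsOpen (I : Set R)) {X : Type u}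
    {r : ZeroConv R X} (hr : r ∈ coeffIn I X) : toFree r ∈ idealMul I (free R X) :=
  ⟨_, map_mem_coeffIn hI hr (point (R := R)), congrArg toFree (openParens_map_point r)⟩

theorem coeff_mem_of_mem_idealMul {I : Submodule Rᵐᵒᵖ R} (hI : IsOpen (I : Set R)) {X : Type u}
    {r : ZeroConv R X} (hr : toFree r ∈ idealMul I (free R X)) : r ∈ coeffIn I X := by
  obtain ⟨ρ, hρ, h⟩ := hr
  have : openParens ρ = r := h
  exact this ▸ openParens_mem_coeffIn hI hρ

theorem app_zero {A B : Contra R} (f : A ⟶ B) : app f 0 = 0 := map_zero (appHom f)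

/-- Projective contramodules are separated: a free contramodule `R[[X]]` is, because an element of
`I R[[X]]` has its coefficients in `I` and `R` is separated, and a projective one is a retract of
a free one. -/
theorem eq_zero_of_forall_mem_idealMul {P : Contra R} (hP : Projective P) {k : P.A}
    (hk : ∀ I : Submodule Rᵐᵒᵖ R, IsOpen (I : Set R) → k ∈ idealMul I P) : k = 0 := by
  have hepi : Epi (lift (R := R) (fun x : P.A => x)) :=
    ⟨fun g g' h => hom_ext fun x => by
      have := congrArg (fun f => app f (toFree (point x))) h
      simpa only [app_comp, app_lift_point] using this⟩
  obtain ⟨σ, hσ⟩ := hP.factors (𝟙 P) (lift (R := R) (fun x : P.A => x))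
  have hz : app σ k = 0 := by
    have : ∀ x, (app σ k : ZeroConv R P.A).coeff x = 0 := fun x => by
      by_contra hne
      obtain ⟨I, hI, hIU⟩ := (IsLinearTopology.hasBasis_open_submodule
        (R := Rᵐᵒᵖ) (M := R)).mem_iff.1 (isOpen_compl_singleton.mem_nhds (Ne.symm hne))
      exact hIU (coeff_mem_of_mem_idealMul hI (app_mem_idealMul hI σ (hk I hI)) x) rfl
    have h0 : (0 : (free R P.A).A) = toFree 0 :=
      congrArg toFree (map_zero (AddMonoidHom.mk' _ (openParens_add (R := R) (X := P.A))))
    rw [h0]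
    exact ZeroConv.ext (funext this)
  rw [← app_id P k, ← hσ, app_comp, hz, app_zero]

/-! ### Coinduced contramodules -/

section Coinduced

variable (I : Submodule Rᵐᵒᵖ R) (D : Type u) [AddCommGroup D]

/-- The additive maps `R → D` vanishing on the right ideal `I`, that is, `Hom(R/I, D)`. -/
def CoindCarrier : Type u := {c : R →+ D // ∀ v ∈ I, c v = 0}

variable {I D} [UniformSpace D] [DiscreteUniformity D]

theorem CoindCarrier.continuous (hI : IsOpen (I : Set R)) (c : CoindCarrier I D) :
    Continuous c.1 := by
  refine continuous_of_continuousAt_zero c.1 ?_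
  refine ContinuousAt.congr (f := fun _ => (0 : D)) continuousAt_const ?_
  filter_upwards [hI.mem_nhds I.zero_mem] with v hv
  exact (c.2 v hv).symm

/-- A family of values `c_i (f_i)` is finitely supported when `f` converges to zero. -/
theorem summable_coind (hI : IsOpen (I : Set R)) {ι : Type*} {f : ι → R}
    (hf : Tendsto f cofinite (𝓝 0)) (c : ι → CoindCarrier I D) :
    Summable fun i => (c i).1 (f i) :=
  summable_of_hasFiniteSupport <| (tendsto_iff.1 hf I hI).subset fun i hi hfi =>
    hi ((c i).2 _ hfi)

theorem summable_coind_coeff (hI : IsOpen (I : Set R)) {X : Type*} (r : ZeroConv R X) (v : R)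
    (c : X → CoindCarrier I D) : Summable fun x => (c x).1 (v * r.coeff x) :=
  summable_coind hI (mulLeft v r).tendsto_zero c

/-- The contraaction on `Hom(R/I, D)`: the value of `∑ r_c c` is `v ↦ ∑ c(v r_c)`, a sum with only
finitely many nonzero terms. -/
noncomputable def coindStr (hI : IsOpen (I : Set R)) (r : ZeroConv R (CoindCarrier I D)) :
    CoindCarrier I D :=
  ⟨AddMonoidHom.mk' (fun v => ∑' c : CoindCarrier I D, c.1 (v * r.coeff c)) fun v w => by
      simp only [add_mul, _root_.map_add]
      exact (summable_coind_coeff hI r v fun c => c).tsum_add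
        (summable_coind_coeff hI r w fun c => c),
    fun v hv => by
      refine (tsum_congr fun c => ?_).trans tsum_zero
      exact c.2 _ (mul_mem_right hv _)⟩

theorem coindStr_apply (hI : IsOpen (I : Set R)) (r : ZeroConv R (CoindCarrier I D)) (v : R) :
    (coindStr hI r).1 v = ∑' c : CoindCarrier I D, c.1 (v * r.coeff c) := rfl

/-- Additive maps `R → D` vanishing on an open right ideal commute with infinite sums. -/
theorem CoindCarrier.apply_mul_tsum (hI : IsOpen (I : Set R)) (c : CoindCarrier I D) {ι : Type*}
    {f : ι → R} (hf : Summable f) (v : R) : c.1 (v * ∑' i, f i) = ∑' i, c.1 (v * f i) := by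
  rw [← hf.tsum_mul_left]
  exact ((hf.mul_left v).hasSum.map c.1 (c.continuous hI)).tsum_eq.symm

/-- The sums defining the contraaction may be indexed by an arbitrary family of elements of
`Hom(R/I, D)`, possibly with repetitions. -/
theorem tsum_coind_map (hI : IsOpen (I : Set R)) {X : Type*} (f : X → CoindCarrier I D)
    (r : ZeroConv R X) (v : R) :
    ∑' c : CoindCarrier I D, c.1 (v * (ZeroConv.map f r).coeff c) =
      ∑' x, (f x).1 (v * r.coeff x) := by
  refine Eq.trans (tsum_congr fun c => ?_)
    ((summable_coind_coeff hI r v f).hasSum.tsum_fiberwise f).tsum_eq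
  have hr : Summable fun x : f ⁻¹' {c} => r.coeff x :=
    (summable r.tendsto_zero).comp_injective Subtype.val_injective
  refine (c.apply_mul_tsum hI hr v).trans (tsum_congr fun x => ?_)
  rw [show f x = c from x.2]

/-- Associativity of the contraaction: both sides are rearrangements of the double sum of the terms
`c(v ρ_s s_c)`, of which only finitely many are nonzero. -/
theorem coindStr_openParens (hI : IsOpen (I : Set R))
    (ρ : ZeroConv R (ZeroConv R (CoindCarrier I D))) :
    coindStr hI (openParens ρ) = coindStr hI (ZeroConv.map (coindStr hI) ρ) := by
  refine Subtype.ext (AddMonoidHom.ext fun v => ?_)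
  rw [coindStr_apply, coindStr_apply, tsum_coind_map hI]
  have hs : Summable (Function.uncurry fun (s : ZeroConv R (CoindCarrier I D))
      (c : CoindCarrier I D) => c.1 (v * (ρ.coeff s * s.coeff c))) :=
    summable_coind hI (f := fun q : ZeroConv R (CoindCarrier I D) × CoindCarrier I D =>
      v * (ρ.coeff q.1 * q.1.coeff q.2))
      (by simpa using (tendsto_open ρ).const_mul v) fun q => q.2
  refine Eq.trans (tsum_congr fun c => ?_) (hs.tsum_comm.trans (tsum_congr fun s => ?_))
  · exact c.apply_mul_tsum hI (summable_open ρ c) v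
  · rw [coindStr_apply]
    simp only [mul_assoc]

/-- The contramodule `Hom(R/I, D)` coinduced from an abelian group `D`, for an open right ideal
`I`. The discrete uniformity on `D` only serves to write finite sums as `tsum`. -/
noncomputable def coind (hI : IsOpen (I : Set R)) (D : Type u) [AddCommGroup D] [UniformSpace D]
    [DiscreteUniformity D] : Contra R :=
  ofStr (CoindCarrier I D) (coindStr hI)
    (fun c => Subtype.ext (AddMonoidHom.ext fun v => by
      classical
      rw [coindStr_apply, tsum_eq_single c]
      · simp [point]
      · intro c' hc
        simp [point, hc]))
    (coindStr_openParens hI)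

/-- The additive map `R → D` that an element of the coinduced contramodule is. -/
def coindFun {hI : IsOpen (I : Set R)} (c : (coind hI D).A) : R →+ D :=
  Subtype.val (p := fun c : R →+ D => ∀ v ∈ I, c v = 0) c

/-- The value at `1` of `∑ r_c c` is `∑ c(r_c)`, whose terms vanish if all `r_c` lie in `I`. -/
theorem coindFun_one_eq_zero {hI : IsOpen (I : Set R)} {c : (coind hI D).A}
    (hc : c ∈ idealMul I (coind hI D)) : coindFun c 1 = 0 := by
  obtain ⟨r, hr, rfl⟩ := hc
  refine (tsum_congr fun c => ?_).trans tsum_zero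
  rw [one_mul]
  exact Subtype.property (p := fun c : R →+ D => ∀ v ∈ I, c v = 0) c _ (hr c)

/-- The map `A → Hom(R/I, D)` corresponding to an additive map `ψ : A → D` that vanishes on the
values of the formal linear combinations with coefficients in `I`: it sends `x` to
`v ↦ ψ (v x)`. -/
noncomputable def toCoind (hI : IsOpen (I : Set R)) {A : Contra R} (ψ : A.A →+ D)
    (hψ : ∀ x ∈ idealMul I A, ψ x = 0) : A ⟶ coind hI D :=
  ofApp (fun x => (⟨(ψ.comp (strHom A)).comp (single x), fun v hv => hψ _ ⟨single x v, by
      classical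
      intro y
      rw [coeff_single]
      split_ifs
      · exact hv
      · exact I.zero_mem, rfl⟩⟩ : CoindCarrier I D)) fun r => by
    refine Subtype.ext (AddMonoidHom.ext fun v => ?_)
    have h : str A (single (str A r) v) = str A (mulLeft v r) := by
      rw [← map_single, ← str_openParens, openParens_single]
    refine (congrArg ψ h).trans ?_
    refine Eq.trans ?_ (tsum_coind_map hI _ r v).symm
    exact apply_eq_tsum_single hI (ψ.comp (strHom A)) (fun s hs => hψ _ ⟨s, hs, rfl⟩)
      (mulLeft v r)

theorem coindFun_toCoind (hI : IsOpen (I : Set R)) {A : Contra R} (ψ : A.A →+ D)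
    (hψ : ∀ x ∈ idealMul I A, ψ x = 0) (x : A.A) (v : R) :
    coindFun (app (toCoind hI ψ hψ) x) v = ψ (str A (single x v)) := rfl

theorem coind_ext {hI : IsOpen (I : Set R)} {c c' : (coind hI D).A}
    (h : ∀ v, coindFun c v = coindFun c' v) : c = c' :=
  Subtype.ext (AddMonoidHom.ext h)

end Coinduced

/-! ### Direct limits modulo an open right ideal -/

/-- The reduction functor `A ↦ A / IA` preserves direct limits: if an element of a term of
a directed diagram becomes zero in the reduction of the colimit, it already becomes zero in the
reduction of a later term. -/
theorem exists_map_mem_idealMul {X : Type u} [PartialOrder X] [IsDirectedOrder X]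
    {P : X ⥤ Contra R} {F : Cocone P} (hF : IsColimit F) {I : Submodule Rᵐᵒᵖ R}
    (hI : IsOpen (I : Set R)) {x : X} {c : (P.obj x).A}
    (hc : app (F.ι.app x) c ∈ idealMul I F.pt) :
    ∃ (y : X) (h : x ≤ y), app (P.map (homOfLE h)) c ∈ idealMul I (P.obj y) := by
  classical
  let G : X → Type u := fun x => (P.obj x).A ⧸ idealMul I (P.obj x)
  let f : ∀ x y, x ≤ y → G x →+ G y := fun x y h =>
    QuotientAddGroup.map _ _ (appHom (P.map (homOfLE h)))
      fun _ hz => app_mem_idealMul hI _ hz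
  have hdir : DirectedSystem G fun x y h => f x y h :=
    { map_self := fun x z => by
        induction z using QuotientAddGroup.induction_on with
        | H z =>
          refine congrArg QuotientAddGroup.mk ?_
          change app (P.map (𝟙 x)) z = z
          rw [P.map_id, app_id]
      map_map := fun x y w hxy hyw z => by
        induction z using QuotientAddGroup.induction_on with
        | H z =>
          refine congrArg QuotientAddGroup.mk ?_
          change app (P.map (homOfLE hyw)) (app (P.map (homOfLE hxy)) z) =
            app (P.map (homOfLE (hxy.trans hyw))) z
          rw [← app_comp, ← P.map_comp]
          rfl }
  let D := AddCommGroup.DirectLimit G f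
  let _ : UniformSpace D := ⊥
  have hdisc : DiscreteUniformity D := ⟨rfl⟩
  let ψ : ∀ x, (P.obj x).A →+ D := fun x =>
    (AddCommGroup.DirectLimit.of G f x).comp (QuotientAddGroup.mk' _)
  have hψ : ∀ x, ∀ z ∈ idealMul I (P.obj x), ψ x z = 0 := fun x z hz => by
    change AddCommGroup.DirectLimit.of G f x (QuotientAddGroup.mk z) = 0
    rw [(QuotientAddGroup.eq_zero_iff z).2 hz, map_zero]
  have hcompat : ∀ {x y : X} (g : x ⟶ y),
      P.map g ≫ toCoind hI (ψ y) (hψ y) = toCoind hI (ψ x) (hψ x) := fun {x y} g => by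
    refine hom_ext fun z => coind_ext fun v => ?_
    rw [app_comp, coindFun_toCoind, coindFun_toCoind, ← map_single, ← app_str]
    exact AddCommGroup.DirectLimit.of_f (G := G) (f := f) (leOfHom g)
      (QuotientAddGroup.mk (str (P.obj x) (single z v)))
  let K : Cocone P :=
    { pt := coind hI D
      ι := { app := fun x => toCoind hI (ψ x) (hψ x)
             naturality := fun x y g => (hcompat g).trans (Category.comp_id _).symm } }
  have h0 : coindFun (app (hF.desc K) (app (F.ι.app x) c)) 1 = 0 :=
    coindFun_one_eq_zero (app_mem_idealMul hI _ hc)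
  rw [← app_comp, hF.fac] at h0
  change coindFun (app (toCoind hI (ψ x) (hψ x)) c) 1 = 0 at h0
  rw [coindFun_toCoind, single_one, str_point] at h0
  obtain ⟨y, hxy, hy⟩ := AddCommGroup.DirectLimit.of.zero_exact (G := G) (f := f) x
    (QuotientAddGroup.mk c) h0
  exact ⟨y, hxy, (QuotientAddGroup.eq_zero_iff _).1 hy⟩

/-! ### Endomorphisms over the direct limit -/

section Cover

variable {X : Type u} [PartialOrder X] [IsDirectedOrder X] {P : X ⥤ Contra R} {F : Cocone P}

/-- Let `Q` be an object over the colimit through which the cocone maps `ι x` factor as `t x`.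
A formal linear combination of elements of the terms of a directed
diagram that vanishes in the colimit is sent into `I Q` by some morphism over the colimit. The
morphism pushes all terms indexed by some `x ≤ y` forward to the index `y`; as all but finitely many
coefficients lie in `I`, it suffices to take `y` large. -/
theorem exists_lift_mem_idealMul [Nonempty X] (hF : IsColimit F) {Q : Contra R} {p : Q ⟶ F.pt}
    {t : ∀ x, P.obj x ⟶ Q} (ht : ∀ x, t x ≫ p = F.ι.app x)
    {w : ZeroConv R (Σ x, (P.obj x).A)}
    (hw : app (lift fun z : Σ x, (P.obj x).A => app (F.ι.app z.1) z.2) (toFree w) = 0)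
    {I : Submodule Rᵐᵒᵖ R} (hI : IsOpen (I : Set R)) :
    ∃ h : free R (Σ x, (P.obj x).A) ⟶ Q,
      h ≫ p = lift (fun z : Σ x, (P.obj x).A => app (F.ι.app z.1) z.2) ∧
        app h (toFree w) ∈ idealMul I Q := by
  classical
  obtain ⟨y₀, hy₀⟩ := ((w.finite_notMem hI).toFinset.image Sigma.fst).exists_le
  let S : Set (Σ x, (P.obj x).A) := {z | z.1 ≤ y₀}
  have hS : ∀ z ∉ S, w.coeff z ∈ I := fun z hz => by
    by_contra hzI
    exact hz (hy₀ _ (Finset.mem_image_of_mem _ (by simpa using hzI)))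
  set e : S → Σ x, (P.obj x).A := fun z => z
  -- The part of `w` with indices outside of `S` has coefficients in `I`.
  have hmod : ∀ {B : Contra R} (g : free R (Σ x, (P.obj x).A) ⟶ B),
      app g (toFree w) - app g (toFree (ZeroConv.map e (restrict S w))) ∈ idealMul I B :=
    fun {B} g => by
      have h := app_mem_idealMul hI g (toFree_mem_idealMul hI (sub_map_restrict_mem hS))
      have h1 : app g (toFree w) =
          app g (toFree (w - ZeroConv.map e (restrict S w))) +
            app g (toFree (ZeroConv.map e (restrict S w))) := by
        rw [app_free g, app_free g, app_free g, ← str_add, ← ZeroConv.map_add, sub_add_cancel]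
      rw [h1, add_sub_cancel_right]
      exact h
  let φ : free R S ⟶ P.obj y₀ := lift fun z => app (P.map (homOfLE z.2)) z.1.2
  have hφ : app (φ ≫ F.ι.app y₀) (toFree (restrict S w)) ∈ idealMul I F.pt := by
    have h := hmod (lift fun z : Σ x, (P.obj x).A => app (F.ι.app z.1) z.2)
    rw [hw, zero_sub, neg_mem_iff, app_lift, ZeroConv.map_map] at h
    have hcomp : φ ≫ F.ι.app y₀ =
        lift (A := F.pt) (fun z : S => app (F.ι.app z.1.1) z.1.2) := free_hom_ext fun z => by
      rw [app_comp, app_lift_point, app_lift_point, ← app_comp, F.w]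
    rw [hcomp]
    exact h
  obtain ⟨y, hy, hφy⟩ := exists_map_mem_idealMul hF hI hφ
  let b : (Σ x, (P.obj x).A) → Q.A := fun z =>
    if h : z.1 ≤ y then app (t y) (app (P.map (homOfLE h)) z.2) else app (t z.1) z.2
  refine ⟨lift b, free_hom_ext fun z => ?_, ?_⟩
  · rw [app_comp, app_lift_point, app_lift_point]
    by_cases h : z.1 ≤ y
    · simp only [b, dif_pos h]
      rw [← app_comp, ht, ← app_comp, F.w]
    · simp only [b, dif_neg h]
      rw [← app_comp, ht]
  · have h1 : app (lift b) (toFree (ZeroConv.map e (restrict S w))) =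
        app (φ ≫ P.map (homOfLE hy) ≫ t y) (toFree (restrict S w)) := by
      rw [app_free (φ ≫ _), app_lift, ZeroConv.map_map]
      congr 2 with z
      rw [app_comp, app_lift_point, app_comp]
      have hz : (e z).1 ≤ y := le_trans z.2 hy
      simp only [b, dif_pos hz]
      rw [← app_comp (P.map (homOfLE z.2)), ← P.map_comp]
      rfl
    rw [← sub_add_cancel (app (lift b) (toFree w))
      (app (lift b) (toFree (ZeroConv.map e (restrict S w)))), h1]
    refine add_mem (h1 ▸ hmod (lift b)) ?_
    exact app_mem_idealMul hI (t y) hφy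

/-- A projective cover of a direct limit of projective contramodules is injective. For each open
right ideal `I`, an element of the kernel is sent into `I Q` by an endomorphism over the limit,
which is an automorphism by the definition of a cover; so the element lies in `I Q`. -/
theorem eq_zero_of_isCover [Nonempty X] (hP : ∀ x, Projective (P.obj x)) (hF : IsColimit F)
    {Q : Contra R} {p : Q ⟶ F.pt} (hp : IsCover (fun A : Contra R => Projective A) p)
    {k : Q.A} (hk : app p k = 0) : k = 0 := by
  choose t ht using fun x => hp.exists_fac _ (F.ι.app x) (hP x)
  let q : free R (Σ x, (P.obj x).A) ⟶ F.pt := lift fun z => app (F.ι.app z.1) z.2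
  have hq : Epi q := ⟨fun g g' h => hF.hom_ext fun x => hom_ext fun c => by
    have := congrArg (fun f => app f (toFree (point ⟨x, c⟩))) h
    simpa only [q, app_comp, app_lift_point] using this⟩
  obtain ⟨s, hs⟩ := hp.mem.factors p q
  refine eq_zero_of_forall_mem_idealMul hp.mem fun I hI => ?_
  have hw : app q (app s k) = 0 := by rw [← app_comp, hs, hk]
  obtain ⟨h, hhp, hh⟩ := exists_lift_mem_idealMul hF ht (w := app s k) hw hI
  have hiso : IsIso (s ≫ h) := hp.isIso_of_fac (s ≫ h) (by rw [Category.assoc, hhp, hs])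
  have hmem := app_mem_idealMul hI (inv (s ≫ h)) (x := app (s ≫ h) k) hh
  rwa [← app_comp, IsIso.hom_inv_id, app_id] at hmem

end Cover

end Contra

theorem mainTheorem2 (R : Type u) [Ring R] [UniformSpace R] [IsUniformAddGroup R]
    [IsTopologicalRing R] [IsLinearTopology Rᵐᵒᵖ R] [CompleteSpace R] [T2Space R]
    (X : Type u) [PartialOrder X] [IsDirectedOrder X]
    (P : X ⥤ Contra R) (hP : ∀ x : X, Projective (P.obj x))
    (F : Cocone P) (hF : IsColimit F) (hcover : HasProjectiveCover F.pt) :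
    Projective F.pt := by
  rcases isEmpty_or_nonempty X with hX | hX
  -- The colimit of the empty diagram is initial.
  · exact ⟨fun {E B} f e _ => ⟨hF.desc ⟨E, ⟨fun x => isEmptyElim x, fun x => isEmptyElim x⟩⟩,
      hF.hom_ext fun x => isEmptyElim x⟩⟩
  obtain ⟨Q, p, hp⟩ := hcover
  have hinj : Function.Injective (Contra.app p) :=
    (injective_iff_map_eq_zero (Contra.appHom p)).2 fun k hk =>
      Contra.eq_zero_of_isCover hP hF hp hk
  choose t ht using fun x => hp.exists_fac _ (F.ι.app x) (hP x)
  -- As `p` is injective, the lifts of the cocone maps to `Q` form a cocone, so `p` splits.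
  have hcompat : ∀ {x y : X} (g : x ⟶ y), P.map g ≫ t y = t x := fun {x y} g =>
    Contra.hom_ext fun z => hinj <| by
      rw [← Contra.app_comp, ← Contra.app_comp, Category.assoc, ht, ht, F.w]
  let K : Cocone P := ⟨Q, ⟨t, fun x y g => (hcompat g).trans (Category.comp_id _).symm⟩⟩
  have hsplit : hF.desc K ≫ p = 𝟙 F.pt := hF.hom_ext fun x => by
    rw [hF.fac_assoc, Category.comp_id]
    exact ht x
  exact (Retract.mk (hF.desc K) p hsplit).projective (p := hp.mem)
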